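/- Let $G=(\mathcal V,\mathcal E)$ be a finite connected multigraph: self-loops are allowed, multiple edges are not, and we write $u - v$ if $\{u,v\}\in\mathcal E$ (so $v - v$ means that $v$ carries a self-loop). For $U\subset\mathcal V$ let $\mathcal E(U)=\{v:\exists u\in U,\ u - v\}$, and call $I\subset\mathcal V$ independent if it includes no edge (in particular, it contains no node with a self-loop). Let $\mathscr M(\mathcal V)$ be the set of probability measures on $\mathcal V$ with exact support $\mathcal V$, and $$\mathrm{Ncond}(G)=\{\mu\in\mathscr M(\mathcal V):\ \mu(I)<\mu(\mathcal E(I))\ \text{for every non-empty independent set } I\}.$$ Let $\mathbb W$ be the set of finite words $w$ over $\mathcal V$ such that $|w|_i|w|_j=0$ whenever $i\ne j$ and $i - j$, and $|w|_i\le 1$ whenever $i - i$; here $|w|_i$ is the number of occurrences of $i$ in $w$. A word lists the classes of the stored items in their order of arrival, and $x(i)=|w|_i$. Given real rewards $(r_S)_{S\in\mathcal E}$ and $\beta\in\mathbb R$, the Max-Weight policy $\Phi$ acts as follows when the state is $w$ and an item of class $v$ arrives. Let $\mathcal P(x,v)=\{j:\ v - j,\ x(j)>0\}$. If $\mathcal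 P(x,v)=\emptyset$, the item is stored and the new state is $wv$. Otherwise a class $j$ is drawn uniformly at random among the maximizers over $\mathcal P(x,v)$ of $\beta\,x(\{v,j\})+r_{\{v,j\}}$, where $x(S)=\sum_{i\in S}x(i)$, and the incoming item leaves together with the oldest stored item of class $j$, so that the new state is $w$ with its first letter $j$ deleted. For $\mu\in\mathscr M(\mathcal V)$, let $(W_n)$ be the resulting Markov chain on $\mathbb W$ when the classes of the successive items are i.i.d. with law $\mu$, and let $$\mathrm{Stab}(G,\Phi)=\{\mu\in\mathscr M(\mathcal V):\ (W_n)\ \text{is positive recurrent}\},$$ where positive recurrent means that for every $w\in\mathbb W$ the mean return time to $w$ of the chain started at $w$ is finite. **Theorem.** If $G$ is not a bipartite graph (that is, it is not the case that $G$ has no self-loop and $\mathcal V$ is the union of two disjoint, possibly empty, independent sets), then every Max-Weight policy $\Phi$ with $\beta>0$, whatever its rewards, is maximal: $$\mathrm{Stab}(G,\Phi)=\mathrm{Ncond}(G).$$ -/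

import Mathlib

/-- A multigraph on the vertex set `V`: self-loops are allowed, multiple edges are not, so that
the edge set is a symmetric relation (`Adj v v` says that there is a self-loop at `v`). -/
structure Multigraph (V : Type*) where
  Adj : V → V → Prop
  symm : ∀ u v, Adj u v → Adj v u

namespace Multigraph

variable {V : Type*} (G : Multigraph V)

/-- Any two vertices are joined by a chain of edges. -/
def Connected : Prop := ∀ u v, Relation.ReflTransGen G.Adj u v

/-- An independent set includes no edge; in particular it contains no vertex with a self-loop. -/
def IsIndep (I : Set V) : Prop := ∀ u ∈ I, ∀ v ∈ I, ¬ G.Adj u v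

/-- A bipartite graph: there is no self-loop, and the vertex set splits into two independent
sets. -/
def IsBipartiteGraph : Prop :=
  (∀ v, ¬ G.Adj v v) ∧ ∃ A : Set V, G.IsIndep A ∧ G.IsIndep Aᶜ

open Classical in
/-- The neighborhood `E(U)` of a set `U` of vertices. -/
noncomputable def nbhd [Fintype V] (U : Finset V) : Finset V :=
  Finset.univ.filter fun v => ∃ u ∈ U, G.Adj u v

end Multigraph

/-- The probability measures on `V` having `V` as exact support. -/
def fullSupportMeasures (V : Type*) : Set (PMF V) := {μ | ∀ v, μ v ≠ 0}

/-- `Ncond(G)`: the probability measures `μ` with full support such that `μ(I) < μ(E(I))` for every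
non-empty independent set `I`. -/
def Multigraph.Ncond {V : Type*} [Fintype V] (G : Multigraph V) : Set (PMF V) :=
  {μ | μ ∈ fullSupportMeasures V ∧
    ∀ I : Finset V, I.Nonempty → G.IsIndep (I : Set V) →
      ∑ i ∈ I, μ i < ∑ i ∈ G.nbhd I, μ i}

section MarkovChain

variable {S : Type*}

/-- The law of `(X₁, …, Xₙ)` for the homogeneous Markov chain with transition probabilities `κ`
and initial state `X₀ = x`. -/
noncomputable def pathLaw (κ : S → PMF S) : ℕ → S → PMF (List S)
  | 0, _ => PMF.pure []
  | n + 1, x => (κ x).bind fun y => (pathLaw κ n y).map fun l => y :: l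

/-- `E_x[T_x] = ∑_{n ≥ 0} P_x(T_x > n)` for the return time `T_x = inf {n ≥ 1 : Xₙ = x}`;
the event `T_x > n` says that `x` is not among `X₁, …, Xₙ`. -/
noncomputable def meanReturnTime (κ : S → PMF S) (x : S) : ENNReal :=
  ∑' n : ℕ, (pathLaw κ n x).toOuterMeasure {l | x ∉ l}

/-- Every state has a finite mean return time. -/
def PositiveRecurrent (κ : S → PMF S) : Prop := ∀ x, meanReturnTime κ x < ⊤

end MarkovChain

namespace Multigraph

variable {V : Type*} [DecidableEq V] (G : Multigraph V)

/-- `w` is an admissible queue detail: no two stored items (at different positions of the word) are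
of compatible classes. Words list the stored items in their order of arrival, oldest first. -/
def IsQueueDetail (w : List V) : Prop :=
  (∀ i j, i ≠ j → G.Adj i j → w.count i * w.count j = 0) ∧ ∀ i, G.Adj i i → w.count i ≤ 1

/-- The state space of queue details. -/
abbrev QueueDetail : Type _ := {w : List V // G.IsQueueDetail w}

theorem IsQueueDetail.erase {G : Multigraph V} {w : List V} (hw : G.IsQueueDetail w) (j : V) :
    G.IsQueueDetail (w.erase j) := by
  have hle : ∀ i, (w.erase j).count i ≤ w.count i := fun i =>
    (List.erase_sublist (a := j) (l := w)).count_le i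
  refine ⟨fun i k hik h => ?_, fun i h => (hle i).trans (hw.2 i h)⟩
  exact Nat.le_zero.mp ((Nat.mul_le_mul (hle i) (hle k)).trans (hw.1 i k hik h).le)

/-- The class detail (commutative image) of a word. -/
def classDetail (w : List V) : V → ℕ := fun i => w.count i

variable [Fintype V]

open Classical in
/-- The classes of the stored items that are compatible with an incoming item of class `v`, if the
class detail is `x`. The class `v` itself is among them if `v` has a self-loop and an item
of class `v` is stored. -/
noncomputable def available (x : V → ℕ) (v : V) : Finset V :=
  Finset.univ.filter fun j => G.Adj v j ∧ 0 < x j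

/-- A class-admissible matching policy: given the class detail and the class of the incoming item,
it draws the class of the match, among the available ones, whenever there is one. -/
structure ClassPolicy where
  choice : (x : V → ℕ) → (v : V) → (G.available x v).Nonempty → PMF V
  support_subset : ∀ x v h, (choice x v h).support ⊆ (G.available x v : Set V)

theorem IsQueueDetail.append {G : Multigraph V} {w : List V} (hw : G.IsQueueDetail w) {v : V}
    (hv : ¬ (G.available (classDetail w) v).Nonempty) : G.IsQueueDetail (w ++ [v]) := by
  have h0 : ∀ j, G.Adj v j → w.count j = 0 := by
    intro j hj
    by_contra hne
    refine hv ⟨j, ?_⟩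
    simp only [available, Finset.mem_filter]
    exact ⟨Finset.mem_univ j, hj, Nat.pos_of_ne_zero hne⟩
  have hc : ∀ i, i ≠ v → (w ++ [v]).count i = w.count i := by
    intro i hi
    simp [List.count_append, Ne.symm hi]
  refine ⟨fun i k hik h => ?_, fun i h => ?_⟩
  · by_cases hi : i = v
    · subst hi
      rw [hc k (Ne.symm hik), h0 k h, Nat.mul_zero]
    · by_cases hk : k = v
      · subst hk
        rw [hc i hi, h0 i (G.symm _ _ h), Nat.zero_mul]
      · rw [hc i hi, hc k hk, hw.1 i k hik h]
  · by_cases hi : i = v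
    · subst hi
      simp [List.count_append, h0 i h]
    · rw [hc i hi]
      exact hw.2 i h

open Classical in
/-- The random action of an incoming item of class `v` on the queue detail `w`: if some stored item
is compatible, the policy draws the class of the match and the oldest stored item of that class
leaves; otherwise the incoming item is stored. -/
noncomputable def arrival (Φ : G.ClassPolicy) (w : G.QueueDetail) (v : V) : PMF G.QueueDetail :=
  if h : (G.available (classDetail w.1) v).Nonempty then
    (Φ.choice (classDetail w.1) v h).map fun j => ⟨w.1.erase j, w.2.erase j⟩
  else PMF.pure ⟨w.1 ++ [v], w.2.append h⟩

/-- The transition probabilities of the chain `(Wₙ)` of queue details: the class of the incoming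
item is drawn from `μ`, independently of everything else. -/
noncomputable def transition (Φ : G.ClassPolicy) (μ : PMF V) (w : G.QueueDetail) :
    PMF G.QueueDetail :=
  μ.bind fun v => G.arrival Φ w v

/-- The stability region `Stab(G, Φ)`. -/
def Stab (Φ : G.ClassPolicy) : Set (PMF V) :=
  {μ | μ ∈ fullSupportMeasures V ∧ PositiveRecurrent (G.transition Φ μ)}

/-- The weight `β x(S) + r(S)` of the edge `S = {v, j}`, where `x(S)` is the sum of `x` over the
set `S` and `r(S)` is the reward of the edge. -/
def weight (β : ℝ) (r : Sym2 V → ℝ) (x : V → ℕ) (v j : V) : ℝ :=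
  β * ∑ i ∈ ({v, j} : Finset V), (x i : ℝ) + r s(v, j)

open Classical in
/-- The available classes `j` for which the edge `{v, j}` has the largest weight. -/
noncomputable def maximizers (β : ℝ) (r : Sym2 V → ℝ) (x : V → ℕ) (v : V) : Finset V :=
  (G.available x v).filter fun j => ∀ k ∈ G.available x v, weight β r x v k ≤ weight β r x v j

theorem maximizers_nonempty (β : ℝ) (r : Sym2 V → ℝ) (x : V → ℕ) (v : V)
    (h : (G.available x v).Nonempty) : (G.maximizers β r x v).Nonempty := by
  obtain ⟨j, hj, hmax⟩ := Finset.exists_max_image _ (weight β r x v) h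
  exact ⟨j, Finset.mem_filter.mpr ⟨hj, hmax⟩⟩

/-- The Max-Weight policy with parameter `β` and rewards `r`; ties are broken uniformly at
random. -/
noncomputable def maxWeight (β : ℝ) (r : Sym2 V → ℝ) : G.ClassPolicy where
  choice x v h := PMF.uniformOfFinset (G.maximizers β r x v) (G.maximizers_nonempty β r x v h)
  support_subset x v h := by
    intro j hj
    rw [PMF.mem_support_uniformOfFinset_iff] at hj
    exact Finset.mem_coe.mpr (Finset.mem_filter.mp hj).1

end Multigraph

/-!
Necessity. Suppose `I` is a non-empty independent set with `μ(E(I)) ≤ μ(I)`, and let `h` and `l` be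
the numbers of stored items with classes in `I` and in `E(I)`. A match removing an item of `I`
involves one of `E(I)`, so `h - l` has nonnegative drift. As no component of the graph is
bipartite, some `u ∉ I` is a neighbor of some `e ∈ E(I)`, and the drift is positive at the word `e`.
So `h - l` has accumulated a fixed positive mean by time `n` on the event that the empty word has
not been revisited; as it is at most `n` there, that event has probability at least `c / n`, which
is not summable.

Sufficiency. Up to constants, the quadratic function `∑ i, x(i)²` has drift at most
`2 ∑ v, μ(v) (x(v) - m(v))`, where `m(v)` is the longest queue compatible with `v`. For `t ≥ 1` the
level set `{x > t}` is independent with neighborhood `{m > t}`, so summing the gaps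
`μ({m > t}) - μ({x > t}) ≥ ε` over the levels `t < max x` bounds this by `-2 ε max x` plus a
constant, and Foster's criterion applies. The Max-Weight policy always matches with a longest
compatible queue up to a constant, because its rewards are bounded.
-/

open scoped ENNReal

theorem tsum_eq_top_of_le_natCast_mul {u : ℕ → ℝ≥0∞} {c : ℝ≥0∞} (hc : c ≠ 0) {N : ℕ}
    (h : ∀ n ≥ N, c ≤ n * u n) : ∑' n, u n = ⊤ := by
  by_contra htop
  have hu : ∀ n, u n ≠ ⊤ := ENNReal.ne_top_of_tsum_ne_top htop
  have hc' : c ≠ ⊤ := ne_top_of_le_ne_top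
    (ENNReal.mul_ne_top (ENNReal.natCast_ne_top N) (hu N)) (h N le_rfl)
  have hle : ∀ n, c.toReal * ((n + N : ℕ) : ℝ)⁻¹ ≤ (u (n + N)).toReal := fun n => by
    have hdiv : c / (n + N : ℕ) ≤ u (n + N) :=
      ENNReal.div_le_of_le_mul' (h (n + N) (Nat.le_add_left N n))
    rw [← div_eq_mul_inv, ← ENNReal.toReal_natCast, ← ENNReal.toReal_div]
    exact ENNReal.toReal_mono (hu _) hdiv
  have hsum : Summable fun n : ℕ => c.toReal * ((n + N : ℕ) : ℝ)⁻¹ :=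
    .of_nonneg_of_le (fun n => by positivity) hle
      ((summable_nat_add_iff N).2 (ENNReal.summable_toReal htop))
  rw [summable_mul_left_iff (ENNReal.toReal_ne_zero.2 ⟨hc, hc'⟩)] at hsum
  exact Real.not_summable_natCast_inv ((summable_nat_add_iff N).1 hsum)

theorem countP_erase_add {α : Type*} [DecidableEq α] {w : List α} {j : α} (hj : j ∈ w)
    (p : α → Bool) :
    (w.erase j).countP p + (if p j then 1 else 0) = w.countP p := by
  rw [(List.perm_cons_erase hj).countP_eq p, List.countP_cons]

section Expectation

variable {α γ : Type*} (p : PMF α)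

/-- The expectation of a nonnegative function under a discrete law, as a sum: no measurable
structure on `α` is involved. -/
noncomputable def lexpect (g : α → ℝ≥0∞) : ℝ≥0∞ := ∑' y, p y * g y

theorem lexpect_add (f g : α → ℝ≥0∞) :
    lexpect p (fun y => f y + g y) = lexpect p f + lexpect p g := by
  simp only [lexpect, mul_add, ENNReal.tsum_add]

theorem lexpect_const_mul (c : ℝ≥0∞) (g : α → ℝ≥0∞) :
    lexpect p (fun y => c * g y) = c * lexpect p g := by
  simp only [lexpect, ← ENNReal.tsum_mul_left, mul_left_comm c]

theorem lexpect_const (c : ℝ≥0∞) : lexpect p (fun _ => c) = c := by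
  simp only [lexpect, ENNReal.tsum_mul_right, p.tsum_coe, one_mul]

variable {p} in
theorem lexpect_mono {f g : α → ℝ≥0∞} (h : ∀ y ∈ p.support, f y ≤ g y) :
    lexpect p f ≤ lexpect p g := by
  refine ENNReal.tsum_le_tsum fun y => ?_
  by_cases hy : p y = 0
  · simp only [hy, zero_mul, le_refl]
  · exact mul_le_mul_right (h y hy) _

theorem mul_le_lexpect (g : α → ℝ≥0∞) (y : α) : p y * g y ≤ lexpect p g :=
  ENNReal.le_tsum y

theorem lexpect_bind (q : α → PMF γ) (g : γ → ℝ≥0∞) :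
    lexpect (p.bind q) g = lexpect p fun a => lexpect (q a) g := by
  simp only [lexpect, PMF.bind_apply, ← ENNReal.tsum_mul_right, ← ENNReal.tsum_mul_left]
  rw [ENNReal.tsum_comm]
  simp only [mul_assoc]

theorem lexpect_eq_sum [Fintype α] (g : α → ℝ≥0∞) : lexpect p g = ∑ y, p y * g y :=
  tsum_fintype _

theorem lexpect_natCast_ne_top [Finite α] (x : α → ℕ) :
    lexpect p (fun v => (x v : ℝ≥0∞)) ≠ ⊤ := by
  have := Fintype.ofFinite α
  rw [lexpect_eq_sum]
  exact ENNReal.sum_ne_top.2 fun v _ =>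
    ENNReal.mul_ne_top (p.apply_ne_top v) (ENNReal.natCast_ne_top _)

theorem lexpect_ite_mem [DecidableEq α] (I : Finset α) :
    lexpect p (fun y => if y ∈ I then 1 else 0) = ∑ y ∈ I, p y := by
  rw [lexpect, tsum_eq_sum (s := I) fun y hy => by rw [if_neg hy, mul_zero]]
  exact Finset.sum_congr rfl fun y hy => by rw [if_pos hy, mul_one]

theorem pmf_sum_le_one (I : Finset α) : ∑ y ∈ I, p y ≤ 1 :=
  (ENNReal.sum_le_tsum I).trans p.tsum_coe.le

variable {p} in
theorem lexpect_lt_one {g : α → ℝ≥0∞} (hg : ∀ y, g y ≤ 1) {z : α} (hz : z ∈ p.support)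
    (hgz : g z < 1) : lexpect p g < 1 := by
  have hle : lexpect p g ≤ 1 := (lexpect_mono fun y _ => hg y).trans (lexpect_const p 1).le
  have hdef : lexpect p g + p z * (1 - g z) ≤ 1 := calc
    lexpect p g + p z * (1 - g z) ≤ lexpect p g + lexpect p (fun y => 1 - g y) := by
      gcongr; exact mul_le_lexpect p (fun y => 1 - g y) z
    _ = 1 := by simp only [← lexpect_add, add_tsub_cancel_of_le (hg _), lexpect_const]
  refine lt_of_lt_of_le (ENNReal.lt_add_right (hle.trans_lt ENNReal.one_lt_top).ne ?_) hdef
  exact mul_ne_zero hz (tsub_pos_of_lt hgz).ne'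

theorem lexpect_natCast_eq_sum_range [Fintype α] {x : α → ℕ} {M : ℕ} (hM : ∀ v, x v ≤ M) :
    lexpect p (fun v => (x v : ℝ≥0∞)) =
      ∑ t ∈ Finset.range M, ∑ v ∈ Finset.univ.filter (fun v => t < x v), p v := by
  have hx : ∀ v, (x v : ℝ≥0∞) = ∑ t ∈ Finset.range M, if t < x v then 1 else 0 := fun v => by
    have hfilter : (Finset.range M).filter (· < x v) = Finset.range (x v) := by
      grind
    rw [Finset.sum_boole, hfilter, Finset.card_range]
  simp only [lexpect_eq_sum, hx, Finset.mul_sum, Finset.sum_filter, mul_ite, mul_one, mul_zero]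
  exact Finset.sum_comm

end Expectation

section KilledChain

variable {S : Type*} {κ : S → PMF S} {a : S}

/-- One-step accessibility: a transition from `x` to `y` has positive probability. -/
def StepsTo (κ : S → PMF S) (x y : S) : Prop := y ∈ (κ x).support

/-- The transition operator of the chain killed when it enters `a`, so that
`(killedOp κ a ^ n) f x` is the expectation of `f Xₙ` on the event that the chain started at `x`
avoids `a` at the times `1, …, n`. The initial state itself may be `a`. -/
noncomputable def killedOp (κ : S → PMF S) (a : S) : Module.End ℝ≥0∞ (S → ℝ≥0∞) where
  toFun f x := lexpect (κ x) (({a}ᶜ : Set S).indicator f)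
  map_add' f g := funext fun x => by
    rw [Set.indicator_add', Pi.add_apply, ← lexpect_add]
    rfl
  map_smul' c f := funext fun x => by
    refine Eq.trans ?_ (lexpect_const_mul (κ x) c _)
    exact congrArg _ (Set.indicator_const_smul _ c f)

theorem killedOp_apply (f : S → ℝ≥0∞) (x : S) :
    killedOp κ a f x = lexpect (κ x) (({a}ᶜ : Set S).indicator f) := rfl

theorem killedOp_le_lexpect (f : S → ℝ≥0∞) (x : S) : killedOp κ a f x ≤ lexpect (κ x) f :=
  lexpect_mono fun _ _ => Set.indicator_le_self _ _ _

theorem killedOp_eq_lexpect {f : S → ℝ≥0∞} (hf : f a = 0) (x : S) :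
    killedOp κ a f x = lexpect (κ x) f := by
  rw [killedOp_apply, Set.indicator_eq_self.2]
  rintro y hy rfl
  exact hy hf

theorem killedOp_pow_succ (n : ℕ) (f : S → ℝ≥0∞) :
    (killedOp κ a ^ (n + 1)) f = (killedOp κ a ^ n) (killedOp κ a f) := by
  rw [pow_succ, Module.End.mul_apply]

theorem killedOp_pow_succ' (n : ℕ) (f : S → ℝ≥0∞) :
    (killedOp κ a ^ (n + 1)) f = killedOp κ a ((killedOp κ a ^ n) f) := by
  rw [pow_succ', Module.End.mul_apply]

theorem killedOp_pow_mono (n : ℕ) : Monotone (killedOp κ a ^ n) := by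
  induction n with
  | zero => exact monotone_id
  | succ n ih =>
    intro f g hfg
    rw [killedOp_pow_succ, killedOp_pow_succ]
    exact ih fun x => lexpect_mono fun y _ => Set.indicator_le_indicator (hfg y)

theorem killedOp_pow_one_le_one (n : ℕ) : (killedOp κ a ^ n) 1 ≤ 1 := by
  induction n with
  | zero => exact le_rfl
  | succ n ih =>
    rw [killedOp_pow_succ]
    refine (killedOp_pow_mono n fun x => ?_).trans ih
    exact (killedOp_le_lexpect 1 x).trans (lexpect_const (κ x) 1).le

theorem killedOp_pow_one_ne_top (n : ℕ) (x : S) : (killedOp κ a ^ n) 1 x ≠ ⊤ :=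
  ((killedOp_pow_one_le_one n x).trans_lt ENNReal.one_lt_top).ne

theorem toOuterMeasure_pathLaw_notMem (n : ℕ) (x : S) :
    (pathLaw κ n x).toOuterMeasure {l | a ∉ l} = (killedOp κ a ^ n) 1 x := by
  classical
  induction n generalizing x with
  | zero => simp [pathLaw, PMF.toOuterMeasure_pure_apply]
  | succ n ih =>
    rw [killedOp_pow_succ', killedOp_apply, pathLaw, PMF.toOuterMeasure_bind_apply]
    refine tsum_congr fun y => ?_
    rw [PMF.toOuterMeasure_map_apply]
    by_cases hy : y = a
    · have hempty : (fun l => y :: l) ⁻¹' {l : List S | a ∉ l} = ∅ := by ext l; simp [hy]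
      rw [hempty, MeasureTheory.measure_empty, Set.indicator_of_notMem (by simpa using hy)]
    · have hcons : (fun l => y :: l) ⁻¹' {l : List S | a ∉ l} = {l | a ∉ l} := by
        ext l; simp [Ne.symm hy]
      rw [hcons, ih, Set.indicator_of_mem (by simpa using hy)]

theorem meanReturnTime_eq_tsum : meanReturnTime κ a = ∑' n, (killedOp κ a ^ n) 1 a :=
  tsum_congr fun n => toOuterMeasure_pathLaw_notMem n a

theorem tsum_killedOp_pow_le_of_drift {L f g : S → ℝ≥0∞} (hdrift : killedOp κ a L + f ≤ L + g)
    (x : S) : ∑' n, (killedOp κ a ^ n) f x ≤ L x + ∑' n, (killedOp κ a ^ n) g x := by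
  have hstep : ∀ n, (killedOp κ a ^ (n + 1)) L x + (killedOp κ a ^ n) f x ≤
      (killedOp κ a ^ n) L x + (killedOp κ a ^ n) g x := fun n => by
    have hmono := killedOp_pow_mono (κ := κ) (a := a) n hdrift x
    rwa [map_add, map_add, ← killedOp_pow_succ] at hmono
  have hpartial : ∀ N, (killedOp κ a ^ N) L x + ∑ n ∈ Finset.range N, (killedOp κ a ^ n) f x ≤
      L x + ∑ n ∈ Finset.range N, (killedOp κ a ^ n) g x := fun N => by
    induction N with
    | zero => simp
    | succ N ih =>
      rw [Finset.sum_range_succ, Finset.sum_range_succ]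
      calc _ = ((killedOp κ a ^ (N + 1)) L x + (killedOp κ a ^ N) f x) +
              ∑ n ∈ Finset.range N, (killedOp κ a ^ n) f x := by ring
        _ ≤ ((killedOp κ a ^ N) L x + (killedOp κ a ^ N) g x) +
              ∑ n ∈ Finset.range N, (killedOp κ a ^ n) f x := add_le_add_left (hstep N) _
        _ = ((killedOp κ a ^ N) L x + ∑ n ∈ Finset.range N, (killedOp κ a ^ n) f x) +
              (killedOp κ a ^ N) g x := by ring
        _ ≤ (L x + ∑ n ∈ Finset.range N, (killedOp κ a ^ n) g x) + (killedOp κ a ^ N) g x := by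
          gcongr
        _ = _ := add_assoc _ _ _
  rw [ENNReal.tsum_eq_iSup_nat]
  refine iSup_le fun N => le_add_self.trans ((hpartial N).trans ?_)
  gcongr
  exact ENNReal.sum_le_tsum _

theorem exists_killedOp_pow_one_lt_one {y : S} (hya : Relation.TransGen (StepsTo κ) y a) :
    ∃ k, (killedOp κ a ^ k) 1 y < 1 := by
  have hle : ∀ k z, ({a}ᶜ : Set S).indicator ((killedOp κ a ^ k) 1) z ≤ 1 := fun k z =>
    (Set.indicator_le_self _ _ _).trans (killedOp_pow_one_le_one k z)
  induction hya using Relation.TransGen.head_induction_on with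
  | single hstep =>
    refine ⟨1, lexpect_lt_one (hle 0) hstep ?_⟩
    rw [Set.indicator_of_notMem (by simp)]
    exact zero_lt_one
  | head hstep _ ih =>
    obtain ⟨k, hk⟩ := ih
    refine ⟨k + 1, ?_⟩
    rw [killedOp_pow_succ']
    exact lexpect_lt_one (hle k) hstep ((Set.indicator_le_self _ _ _).trans_lt hk)

/- From each visit to `y` the chain enters `a` within `k` steps with probability at least `δ`, so
the expected number of visits to `y` is at most `k / δ`. -/
theorem tsum_killedOp_pow_indicator_lt_top {y : S} (hya : Relation.TransGen (StepsTo κ) y a)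
    (x : S) : ∑' n, (killedOp κ a ^ n) (({y} : Set S).indicator 1) x < ⊤ := by
  obtain ⟨k, hk⟩ := exists_killedOp_pow_one_lt_one hya
  set δ := 1 - (killedOp κ a ^ k) 1 y
  have hδ : δ ≠ 0 := (tsub_pos_of_lt hk).ne'
  set visit : S → ℝ≥0∞ := ({y} : Set S).indicator 1
  have hloss : (killedOp κ a ^ k) 1 + δ • visit ≤ 1 := fun z => by
    by_cases hz : z = y
    · simpa [visit, hz] using (add_tsub_cancel_of_le hk.le).le
    · simpa [visit, hz] using killedOp_pow_one_le_one k z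
  set L : S → ℝ≥0∞ := ∑ n ∈ Finset.range k, (killedOp κ a ^ n) 1
  have hL : killedOp κ a L + 1 = L + (killedOp κ a ^ k) 1 := by
    rw [← Finset.sum_range_succ, Finset.sum_range_succ', map_sum]
    simp only [killedOp_pow_succ', pow_zero, Module.End.one_apply]
  have hdrift : killedOp κ a L + δ • visit ≤ L + 0 := fun z => by
    refine (ENNReal.add_le_add_iff_right ENNReal.one_ne_top).1 ?_
    calc (killedOp κ a L + δ • visit) z + 1 = (killedOp κ a L + 1 + δ • visit) z :=
          add_right_comm _ _ _
      _ = (L + ((killedOp κ a ^ k) 1 + δ • visit)) z := by rw [hL, add_assoc]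
      _ ≤ (L + 0) z + 1 := by rw [add_zero]; exact add_le_add_right (hloss z) _
  have hLx : L x ≠ ⊤ := by
    rw [show L x = ∑ n ∈ Finset.range k, (killedOp κ a ^ n) 1 x from Finset.sum_apply ..]
    exact ENNReal.sum_ne_top.2 fun n _ => killedOp_pow_one_ne_top n x
  have hvisits : δ * ∑' n, (killedOp κ a ^ n) visit x ≤ L x := by
    simpa [ENNReal.tsum_mul_left] using tsum_killedOp_pow_le_of_drift hdrift x
  exact lt_top_iff_ne_top.2 fun htop =>
    hLx (top_le_iff.1 (by rwa [htop, ENNReal.mul_top hδ] at hvisits))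

theorem meanReturnTime_lt_top_of_drift {F : Finset S}
    (hF : ∀ y ∈ F, Relation.TransGen (StepsTo κ) y a) {L : S → ℝ≥0∞} (hL : L a ≠ ⊤)
    {c : ℝ≥0∞} (hc : c ≠ ⊤)
    (hdrift : ∀ x, lexpect (κ x) L + 1 ≤ L x + (F : Set S).indicator (fun _ => c) x) :
    meanReturnTime κ a < ⊤ := by
  have hindicator : (F : Set S).indicator (fun _ => c) =
      c • ∑ y ∈ F, ({y} : Set S).indicator (1 : S → ℝ≥0∞) := by
    classical
    ext x
    simp [Finset.sum_apply, Set.indicator_apply]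
  have hkilled : killedOp κ a L + 1 ≤ L + c • ∑ y ∈ F, ({y} : Set S).indicator 1 := fun x => by
    rw [← hindicator]
    exact (add_le_add_left (killedOp_le_lexpect L x) 1).trans (hdrift x)
  have hvisits : ∑' n, (killedOp κ a ^ n) (c • ∑ y ∈ F, ({y} : Set S).indicator 1) a < ⊤ := by
    simp only [map_smul, map_sum, Pi.smul_apply, Finset.sum_apply, smul_eq_mul,
      ENNReal.tsum_mul_left]
    rw [Summable.tsum_finsetSum fun _ _ => ENNReal.summable]
    exact ENNReal.mul_lt_top hc.lt_top
      (ENNReal.sum_lt_top.2 fun y hy => tsum_killedOp_pow_indicator_lt_top (hF y hy) a)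
  rw [meanReturnTime_eq_tsum]
  exact (tsum_killedOp_pow_le_of_drift hkilled a).trans_lt
    (ENNReal.add_lt_top.2 ⟨hL.lt_top, hvisits⟩)

theorem positiveRecurrent_of_drift (hirr : ∀ x y, Relation.ReflTransGen (StepsTo κ) x y)
    {L : S → ℝ≥0∞} (hL : ∀ x, L x ≠ ⊤) {F : Finset S} {c : ℝ≥0∞} (hc : c ≠ ⊤)
    (hdrift : ∀ x, lexpect (κ x) L + 1 ≤ L x + (F : Set S).indicator (fun _ => c) x) :
    PositiveRecurrent κ := fun a => by
  refine meanReturnTime_lt_top_of_drift (fun y _ => ?_) (hL a) hc hdrift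
  obtain ⟨z, hz⟩ := (κ y).support_nonempty
  exact Relation.TransGen.head' hz (hirr z a)

theorem killedOp_pow_le_of_step_le {f : S → ℝ≥0∞} (hf : ∀ x y, StepsTo κ x y → f y ≤ f x + 1)
    (n : ℕ) (x : S) : (killedOp κ a ^ n) f x ≤ (f x + n) * (killedOp κ a ^ n) 1 x := by
  induction n generalizing x with
  | zero => simp
  | succ n ih =>
    simp only [killedOp_pow_succ', killedOp_apply, ← lexpect_const_mul]
    refine lexpect_mono fun y hy => ?_
    by_cases hya : y ∈ ({a}ᶜ : Set S)
    · rw [Set.indicator_of_mem hya, Set.indicator_of_mem hya]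
      refine (ih y).trans ?_
      gcongr ?_ * _
      calc f y + n ≤ f x + 1 + n := by gcongr; exact hf x y hy
        _ = f x + (n + 1 : ℕ) := by push_cast; ring
    · simp only [Set.indicator_of_notMem hya, zero_le]

theorem killedOp_pow_add_sum_le_of_drift {h l d : S → ℝ≥0∞} {x : S}
    (hl : ∀ n, (killedOp κ a ^ n) l x ≠ ⊤) (hdrift : h + killedOp κ a l + d ≤ killedOp κ a h + l)
    (N : ℕ) : h x + (killedOp κ a ^ N) l x + ∑ n ∈ Finset.range N, (killedOp κ a ^ n) d x ≤
      (killedOp κ a ^ N) h x + l x := by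
  induction N with
  | zero => simp
  | succ N ih =>
    have hstep : (killedOp κ a ^ N) h x + (killedOp κ a ^ (N + 1)) l x + (killedOp κ a ^ N) d x ≤
        (killedOp κ a ^ (N + 1)) h x + (killedOp κ a ^ N) l x := by
      have hmono := killedOp_pow_mono (κ := κ) (a := a) N hdrift x
      rwa [map_add, map_add, map_add, ← killedOp_pow_succ, ← killedOp_pow_succ] at hmono
    rw [Finset.sum_range_succ]
    refine (ENNReal.add_le_add_iff_right (hl N)).1 ?_
    calc _ = (h x + (killedOp κ a ^ N) l x + ∑ n ∈ Finset.range N, (killedOp κ a ^ n) d x) +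
            (killedOp κ a ^ (N + 1)) l x + (killedOp κ a ^ N) d x := by ring
      _ ≤ ((killedOp κ a ^ N) h x + l x) +
            (killedOp κ a ^ (N + 1)) l x + (killedOp κ a ^ N) d x := by gcongr
      _ = ((killedOp κ a ^ N) h x + (killedOp κ a ^ (N + 1)) l x + (killedOp κ a ^ N) d x) +
            l x := by ring
      _ ≤ ((killedOp κ a ^ (N + 1)) h x + (killedOp κ a ^ N) l x) + l x := by gcongr
      _ = _ := by ring

theorem not_positiveRecurrent_of_drift {z : S} {h l d : S → ℝ≥0∞}
    (hh : ∀ x y, StepsTo κ x y → h y ≤ h x + 1) (hl : ∀ x y, StepsTo κ x y → l y ≤ l x + 1)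
    (hha : h a = 0) (hla : l a = 0)
    (hdrift : ∀ x, h x + lexpect (κ x) l + d x ≤ lexpect (κ x) h + l x)
    (hza : z ≠ a) (haz : StepsTo κ a z) (hdz : d z ≠ 0) : ¬ PositiveRecurrent κ := by
  intro hpos
  have growth {f : S → ℝ≥0∞} (hf : ∀ x y, StepsTo κ x y → f y ≤ f x + 1) (hfa : f a = 0) (n : ℕ) :
      (killedOp κ a ^ n) f a ≤ n * (killedOp κ a ^ n) 1 a := by
    simpa only [hfa, zero_add] using killedOp_pow_le_of_step_le hf n a
  have hl_top : ∀ n, (killedOp κ a ^ n) l a ≠ ⊤ := fun n => ne_top_of_le_ne_top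
    (ENNReal.mul_ne_top (ENNReal.natCast_ne_top n) (killedOp_pow_one_ne_top n a)) (growth hl hla n)
  have hkilled : h + killedOp κ a l + d ≤ killedOp κ a h + l := fun x => by
    simpa only [Pi.add_apply, killedOp_eq_lexpect hha, killedOp_eq_lexpect hla] using hdrift x
  have hd_sum : ∀ N, ∑ n ∈ Finset.range N, (killedOp κ a ^ n) d a ≤ (killedOp κ a ^ N) h a :=
    fun N => by
      have hsum := killedOp_pow_add_sum_le_of_drift hl_top hkilled N
      rw [hla, add_zero] at hsum
      exact le_add_self.trans hsum
  have hda : killedOp κ a d a ≠ 0 := by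
    have hle := mul_le_lexpect (κ a) (({a}ᶜ : Set S).indicator d) z
    rw [Set.indicator_of_mem (by simpa using hza)] at hle
    exact ((pos_iff_ne_zero.2 (mul_ne_zero haz hdz)).trans_le hle).ne'
  have hsurvival : ∀ n ≥ 2, killedOp κ a d a ≤ (n : ℕ) * (killedOp κ a ^ n) 1 a := fun n hn => calc
    killedOp κ a d a = (killedOp κ a ^ 1) d a := by rw [pow_one]
    _ ≤ ∑ n ∈ Finset.range n, (killedOp κ a ^ n) d a :=
      Finset.single_le_sum (f := fun n => (killedOp κ a ^ n) d a) (fun _ _ => zero_le)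
        (Finset.mem_range.2 hn)
    _ ≤ (killedOp κ a ^ n) h a := hd_sum n
    _ ≤ n * (killedOp κ a ^ n) 1 a := growth hh hha n
  exact (hpos a).ne (meanReturnTime_eq_tsum.trans (tsum_eq_top_of_le_natCast_mul hda hsurvival))

end KilledChain

namespace Multigraph

variable {V : Type*} {G : Multigraph V}

section Neighborhoods

variable [Fintype V]

theorem mem_nbhd {U : Finset V} {v : V} : v ∈ G.nbhd U ↔ ∃ u ∈ U, G.Adj u v := by
  simp only [nbhd, Finset.mem_filter, Finset.mem_univ, true_and]

theorem mem_available {x : V → ℕ} {v j : V} : j ∈ G.available x v ↔ G.Adj v j ∧ 0 < x j := by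
  simp only [available, Finset.mem_filter, Finset.mem_univ, true_and]

theorem notMem_of_mem_nbhd {I : Finset V} (hI : G.IsIndep (I : Set V)) {v : V}
    (hv : v ∈ G.nbhd I) : v ∉ I := fun h => by
  obtain ⟨u, hu, huv⟩ := mem_nbhd.1 hv
  exact hI u hu v h huv

variable (G) in
/-- No connected component of `G` is bipartite. The encoding avoids connected components: a
non-empty independent set `I` satisfies `E(E(I)) ⊆ I` if and only if it consists of one side of
each of some bipartite components, an isolated vertex without self-loop being such a component. -/
def HasNoBipartiteComponent : Prop :=
  ∀ I : Finset V, I.Nonempty → G.IsIndep (I : Set V) → ¬ G.nbhd (G.nbhd I) ⊆ I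

theorem hasNoBipartiteComponent_of_connected (hconn : G.Connected)
    (hbip : ¬ G.IsBipartiteGraph) : G.HasNoBipartiteComponent := by
  rintro I ⟨i, hi⟩ hI hsub
  have hcover : ∀ v, v ∈ I ∨ v ∈ G.nbhd I := fun v => by
    induction hconn i v with
    | refl => exact .inl hi
    | tail _ huv ih =>
      exact ih.symm.imp (fun hu => hsub (mem_nbhd.2 ⟨_, hu, huv⟩))
        fun hu => mem_nbhd.2 ⟨_, hu, huv⟩
  have hIc : G.IsIndep (I : Set V)ᶜ := fun u hu v hv huv =>
    hv (hsub (mem_nbhd.2 ⟨u, (hcover u).resolve_left hu, huv⟩))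
  refine hbip ⟨fun v hv => ?_, I, hI, hIc⟩
  by_cases hvI : v ∈ I
  · exact hI v hvI v hvI hv
  · exact hIc v hvI v hvI hv

theorem exists_adj_of_mem_Ncond {μ : PMF V} (hμ : μ ∈ G.Ncond) (v : V) : ∃ u, G.Adj v u := by
  by_contra! hv
  have hempty : G.nbhd {v} = ∅ := Finset.eq_empty_of_forall_notMem fun u hu => by
    obtain ⟨_, rfl, hadj⟩ := by simpa only [mem_nbhd, Finset.mem_singleton] using hu
    exact hv u hadj
  have hindep : G.IsIndep (({v} : Finset V) : Set V) := fun u hu w _ huw => by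
    obtain rfl : u = v := by simpa using hu
    exact hv w huw
  simpa [hempty] using hμ.2 {v} (Finset.singleton_nonempty v) hindep

theorem exists_gap_of_mem_Ncond {μ : PMF V} (hμ : μ ∈ G.Ncond) :
    ∃ ε : ℝ≥0∞, ε ≠ 0 ∧ ε ≤ 1 ∧ ∀ I : Finset V, I.Nonempty → G.IsIndep (I : Set V) →
      ∑ i ∈ I, μ i + ε ≤ ∑ i ∈ G.nbhd I, μ i := by
  classical
  set s : Finset (Finset V) :=
    Finset.univ.filter fun I => I.Nonempty ∧ G.IsIndep (I : Set V)
  set gap : Finset V → ℝ≥0∞ := fun I => ∑ i ∈ G.nbhd I, μ i - ∑ i ∈ I, μ i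
  have hpos : 0 < s.inf gap := by
    rw [Finset.lt_inf_iff ENNReal.zero_lt_top]
    intro I hI
    obtain ⟨hne, hindep⟩ := (Finset.mem_filter.1 hI).2
    exact tsub_pos_of_lt (hμ.2 I hne hindep)
  refine ⟨min 1 (s.inf gap), (lt_min one_pos hpos).ne', min_le_left _ _, fun I hne hI => ?_⟩
  have hmem : I ∈ s := Finset.mem_filter.2 ⟨Finset.mem_univ _, hne, hI⟩
  calc ∑ i ∈ I, μ i + min 1 (s.inf gap)
      ≤ ∑ i ∈ I, μ i + gap I := by gcongr; exact (min_le_right _ _).trans (Finset.inf_le hmem)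
    _ = ∑ i ∈ G.nbhd I, μ i := add_tsub_cancel_of_le (hμ.2 I hne hI).le

variable (G) in
/-- The largest number of stored items of a class compatible with an incoming item of class `v`;
it is `0` if there is no such class. -/
noncomputable def maxNeighbor (x : V → ℕ) (v : V) : ℕ :=
  open Classical in (Finset.univ.filter fun j => G.Adj v j).sup x

theorem lt_maxNeighbor {x : V → ℕ} {v : V} {t : ℕ} :
    t < G.maxNeighbor x v ↔ ∃ j, G.Adj v j ∧ t < x j := by
  simp only [maxNeighbor, Finset.lt_sup_iff, Finset.mem_filter, Finset.mem_univ, true_and]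

theorem maxNeighbor_le {x : V → ℕ} {v : V} {t : ℕ} :
    G.maxNeighbor x v ≤ t ↔ ∀ j, G.Adj v j → x j ≤ t := by
  simp only [maxNeighbor, Finset.sup_le_iff, Finset.mem_filter, Finset.mem_univ, true_and]

theorem filter_lt_maxNeighbor (x : V → ℕ) (t : ℕ) :
    (Finset.univ.filter fun v => t < G.maxNeighbor x v) =
      G.nbhd (Finset.univ.filter fun v => t < x v) := by
  ext v
  simp only [Finset.mem_filter, Finset.mem_univ, true_and, mem_nbhd, lt_maxNeighbor]
  exact ⟨fun ⟨j, hvj, hj⟩ => ⟨j, hj, G.symm _ _ hvj⟩, fun ⟨j, hj, hjv⟩ => ⟨j, G.symm _ _ hjv, hj⟩⟩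

end Neighborhoods

section QueueDetails

variable [DecidableEq V]

theorem isQueueDetail_nil : G.IsQueueDetail [] := by
  constructor <;> simp

theorem IsQueueDetail.of_append {w : List V} {v : V} (h : G.IsQueueDetail (w ++ [v])) :
    G.IsQueueDetail w := by
  have hle : ∀ i, w.count i ≤ (w ++ [v]).count i := fun i =>
    (List.sublist_append_left w [v]).count_le i
  refine ⟨fun i k hik hadj => ?_, fun i hi => (hle i).trans (h.2 i hi)⟩
  exact Nat.le_zero.1 ((Nat.mul_le_mul (hle i) (hle k)).trans (h.1 i k hik hadj).le)

variable [Fintype V]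

theorem IsQueueDetail.isIndep_lt {w : List V} (hw : G.IsQueueDetail w) {t : ℕ} (ht : t ≠ 0) :
    G.IsIndep ((Finset.univ.filter fun v => t < classDetail w v : Finset V) : Set V) := by
  intro u hu v hv huv
  have hu_pos : t < w.count u := (Finset.mem_filter.1 hu).2
  have hv_pos : t < w.count v := (Finset.mem_filter.1 hv).2
  by_cases huv_eq : u = v
  · subst huv_eq
    have hloop := hw.2 u huv
    omega
  · rcases Nat.mul_eq_zero.1 (hw.1 u v huv_eq huv) with h0 | h0 <;> omega

theorem IsQueueDetail.not_available {w : List V} {v : V} (h : G.IsQueueDetail (w ++ [v])) :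
    ¬ (G.available (classDetail w) v).Nonempty := by
  rintro ⟨j, hj⟩
  obtain ⟨hadj, hpos⟩ := mem_available.1 hj
  simp only [classDetail] at hpos
  by_cases hjv : j = v
  · subst hjv
    have hloop := h.2 j hadj
    simp only [List.count_append, List.count_singleton_self] at hloop
    omega
  · have hzero := h.1 v j (Ne.symm hjv) hadj
    simp only [List.count_append, List.count_singleton_self, Nat.mul_eq_zero] at hzero
    omega

theorem finite_setOf_sup_classDetail_lt (G : Multigraph V) (K : ℕ) :
    {w : G.QueueDetail | Finset.univ.sup (classDetail w.1) < K}.Finite := by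
  refine Set.Finite.of_finite_image (f := Subtype.val) ?_ Subtype.val_injective.injOn
  refine (List.finite_length_le V (Fintype.card V * K)).subset ?_
  rintro _ ⟨w, hw, rfl⟩
  have hlength : ∑ i, w.1.count i = w.1.length := by
    simpa using Multiset.sum_count_eq_card (s := Finset.univ) (m := (w.1 : Multiset V)) (by simp)
  have hbound : ∑ i, w.1.count i ≤ ∑ _i : V, K := Finset.sum_le_sum fun i _ =>
    (Finset.le_sup (f := classDetail w.1) (Finset.mem_univ i)).trans (le_of_lt hw)
  simpa [hlength] using hbound

end QueueDetails

section Transitions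

variable [DecidableEq V] [Fintype V] {Φ : G.ClassPolicy} {μ : PMF V}

theorem adj_and_mem_of_mem_support_choice {w : List V} {v j : V}
    {h : (G.available (classDetail w) v).Nonempty}
    (hj : j ∈ (Φ.choice (classDetail w) v h).support) : G.Adj v j ∧ j ∈ w := by
  obtain ⟨hadj, hpos⟩ := mem_available.1 (Φ.support_subset _ _ _ hj)
  exact ⟨hadj, List.count_pos_iff.1 hpos⟩

theorem append_or_erase_of_mem_support_arrival {w y : G.QueueDetail} {v : V}
    (hy : y ∈ (G.arrival Φ w v).support) :
    (¬ (G.available (classDetail w.1) v).Nonempty ∧ y.1 = w.1 ++ [v]) ∨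
      ∃ h, ∃ j ∈ (Φ.choice (classDetail w.1) v h).support, y.1 = w.1.erase j := by
  unfold arrival at hy
  split_ifs at hy with h
  · obtain ⟨j, hj, rfl⟩ := (PMF.mem_support_map_iff ..).1 hy
    exact .inr ⟨h, j, hj, rfl⟩
  · exact .inl ⟨h, congrArg Subtype.val ((PMF.mem_support_pure_iff ..).1 hy)⟩

theorem stepsTo_transition_iff {w y : G.QueueDetail} :
    StepsTo (G.transition Φ μ) w y ↔ ∃ v ∈ μ.support, y ∈ (G.arrival Φ w v).support :=
  PMF.mem_support_bind_iff ..

theorem stepsTo_append (hμ : μ ∈ fullSupportMeasures V) {w : List V} {v : V}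
    (h : G.IsQueueDetail (w ++ [v])) :
    StepsTo (G.transition Φ μ) ⟨w, h.of_append⟩ ⟨w ++ [v], h⟩ := by
  refine stepsTo_transition_iff.2 ⟨v, hμ v, ?_⟩
  rw [arrival, dif_neg h.not_available, PMF.mem_support_pure_iff]

theorem exists_stepsTo_length_lt (hadj : ∀ v, ∃ u, G.Adj v u) (hμ : μ ∈ fullSupportMeasures V)
    {w : G.QueueDetail} (hw : w.1 ≠ []) :
    ∃ y, StepsTo (G.transition Φ μ) w y ∧ y.1.length < w.1.length := by
  obtain ⟨i, hi⟩ := List.exists_mem_of_ne_nil _ hw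
  obtain ⟨v, hiv⟩ := hadj i
  have hav : (G.available (classDetail w.1) v).Nonempty :=
    ⟨i, mem_available.2 ⟨G.symm _ _ hiv, List.count_pos_iff.2 hi⟩⟩
  obtain ⟨y, hy⟩ := (G.arrival Φ w v).support_nonempty
  refine ⟨y, stepsTo_transition_iff.2 ⟨v, hμ v, hy⟩, ?_⟩
  rcases append_or_erase_of_mem_support_arrival hy with ⟨hnot, -⟩ | ⟨_, j, hj, hyj⟩
  · exact absurd hav hnot
  · have hjw := (adj_and_mem_of_mem_support_choice hj).2
    rw [hyj, List.length_erase_of_mem hjw]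
    exact Nat.sub_one_lt (List.length_pos_of_mem hjw).ne'

theorem reflTransGen_stepsTo_transition (hadj : ∀ v, ∃ u, G.Adj v u)
    (hμ : μ ∈ fullSupportMeasures V) (w y : G.QueueDetail) :
    Relation.ReflTransGen (StepsTo (G.transition Φ μ)) w y := by
  have hdown : ∀ w : G.QueueDetail,
      Relation.ReflTransGen (StepsTo (G.transition Φ μ)) w ⟨[], isQueueDetail_nil⟩ := by
    intro w
    induction hn : w.1.length using Nat.strong_induction_on generalizing w with
    | _ n ih =>
      by_cases hw : w.1 = []
      · obtain rfl : w = ⟨[], isQueueDetail_nil⟩ := Subtype.ext hw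
        exact .refl
      · obtain ⟨z, hz, hlt⟩ := exists_stepsTo_length_lt hadj hμ hw
        exact .head hz (ih _ (hn ▸ hlt) z rfl)
  have hup : ∀ (l : List V) (hl : G.IsQueueDetail l),
      Relation.ReflTransGen (StepsTo (G.transition Φ μ)) ⟨[], isQueueDetail_nil⟩ ⟨l, hl⟩ := by
    intro l
    induction l using List.reverseRecOn with
    | nil => exact fun _ => .refl
    | append_singleton l v ih => exact fun hl => (ih hl.of_append).tail (stepsTo_append hμ hl)
  exact (hdown w).trans (hup y.1 y.2)

theorem lexpect_transition_add_le {w : G.QueueDetail} {f g : G.QueueDetail → ℝ≥0∞}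
    {A B : V → ℝ≥0∞} (h : ∀ v, ∀ y ∈ (G.arrival Φ w v).support, f y + A v ≤ g y + B v) :
    lexpect (G.transition Φ μ w) f + lexpect μ A ≤
      lexpect (G.transition Φ μ w) g + lexpect μ B := by
  have harrival : ∀ v, lexpect (G.arrival Φ w v) f + A v ≤ lexpect (G.arrival Φ w v) g + B v :=
    fun v => by simpa only [lexpect_add, lexpect_const] using lexpect_mono (h v)
  simpa only [transition, lexpect_bind, lexpect_add] using
    lexpect_mono (p := μ) fun v _ => harrival v

end Transitions

section Necessity

variable [DecidableEq V] [Fintype V] {Φ : G.ClassPolicy} {μ : PMF V}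

theorem countP_le_of_stepsTo {w y : G.QueueDetail} (h : StepsTo (G.transition Φ μ) w y)
    (p : V → Bool) : y.1.countP p ≤ w.1.countP p + 1 := by
  obtain ⟨v, -, hy⟩ := stepsTo_transition_iff.1 h
  rcases append_or_erase_of_mem_support_arrival hy with ⟨-, hyv⟩ | ⟨_, j, -, hyj⟩
  · rw [hyv, List.countP_append]
    exact Nat.add_le_add_left List.countP_le_length _
  · rw [hyj]
    exact (List.erase_sublist.countP_le).trans (Nat.le_succ _)

theorem ite_mem_add_le_of_adj {I : Finset V} (hI : G.IsIndep (I : Set V)) {v j : V}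
    (hvj : G.Adj v j) :
    (if v ∈ I then 1 else 0) + (if j ∈ I then 1 else 0) +
        (if v ∉ I ∧ j ∈ G.nbhd I then 1 else 0) ≤
      (if v ∈ G.nbhd I then 1 else 0) + if j ∈ G.nbhd I then 1 else 0 := by
  have hj : v ∈ I → j ∈ G.nbhd I := fun hv => mem_nbhd.2 ⟨v, hv, hvj⟩
  have hv : j ∈ I → v ∈ G.nbhd I := fun hj => mem_nbhd.2 ⟨j, hj, G.symm _ _ hvj⟩
  have hjI : j ∈ G.nbhd I → j ∉ I := notMem_of_mem_nbhd hI
  grind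

/- A match changes the number of stored items in `I` minus the number of those in `E(I)` at least
as much as storing the arrival would. It does strictly better when an arrival off `I` leaves
with an item of `E(I)`, which is what happens when `u` meets `[e]`. -/
theorem countP_arrival_le {I : Finset V} (hI : G.IsIndep (I : Set V)) {e u : V}
    (he : e ∈ G.nbhd I) (hu : u ∉ I) (heu : G.Adj e u) {w y : G.QueueDetail} {v : V}
    (hy : y ∈ (G.arrival Φ w v).support) :
    y.1.countP (· ∈ G.nbhd I) + (w.1.countP (· ∈ I) + (if v ∈ I then 1 else 0) +
        (if w.1 = [e] ∧ v = u then 1 else 0)) ≤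
      y.1.countP (· ∈ I) + (w.1.countP (· ∈ G.nbhd I) + if v ∈ G.nbhd I then 1 else 0) := by
  rcases append_or_erase_of_mem_support_arrival hy with ⟨hnot, hyv⟩ | ⟨_, j, hj, hyj⟩
  · have hbonus : ¬ (w.1 = [e] ∧ v = u) := by
      rintro ⟨hw, rfl⟩
      exact hnot ⟨e, mem_available.2 ⟨G.symm _ _ heu, by simp [classDetail, hw]⟩⟩
    simp only [hyv, List.countP_append, List.countP_singleton, decide_eq_true_eq, if_neg hbonus]
    omega
  · obtain ⟨hvj, hjw⟩ := adj_and_mem_of_mem_support_choice hj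
    have hbonus : (if w.1 = [e] ∧ v = u then 1 else 0) ≤
        if v ∉ I ∧ j ∈ G.nbhd I then 1 else 0 := by
      have himp : w.1 = [e] ∧ v = u → v ∉ I ∧ j ∈ G.nbhd I := by
        rintro ⟨hw, rfl⟩
        obtain rfl : j = e := by simpa [hw] using hjw
        exact ⟨hu, he⟩
      split_ifs <;> grind
    have hpair := ite_mem_add_le_of_adj hI hvj
    have hcount := countP_erase_add hjw (· ∈ I)
    have hcount_nbhd := countP_erase_add hjw (· ∈ G.nbhd I)
    simp only [decide_eq_true_eq] at hcount hcount_nbhd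
    rw [hyj]
    omega

theorem lexpect_countP_add_le {I : Finset V} (hI : G.IsIndep (I : Set V))
    (hle : ∑ i ∈ G.nbhd I, μ i ≤ ∑ i ∈ I, μ i) {e u : V} (he : e ∈ G.nbhd I) (hu : u ∉ I)
    (heu : G.Adj e u) (w : G.QueueDetail) :
    (w.1.countP (· ∈ I) : ℝ≥0∞) +
        lexpect (G.transition Φ μ w) (fun y => (y.1.countP (· ∈ G.nbhd I) : ℝ≥0∞)) +
        (if w.1 = [e] then μ u else 0) ≤
      lexpect (G.transition Φ μ w) (fun y => (y.1.countP (· ∈ I) : ℝ≥0∞)) +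
        w.1.countP (· ∈ G.nbhd I) := by
  have hmean := lexpect_transition_add_le (μ := μ) (Φ := Φ) (w := w)
    (f := fun y => (y.1.countP (· ∈ G.nbhd I) : ℝ≥0∞)) (g := fun y => (y.1.countP (· ∈ I) : ℝ≥0∞))
    (A := fun v => (w.1.countP (· ∈ I) : ℝ≥0∞) + (if v ∈ I then 1 else 0) +
      (if w.1 = [e] ∧ v = u then 1 else 0))
    (B := fun v => (w.1.countP (· ∈ G.nbhd I) : ℝ≥0∞) + if v ∈ G.nbhd I then 1 else 0)
    fun v y hy => by exact_mod_cast countP_arrival_le hI he hu heu hy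
  have hbonus : lexpect μ (fun v => if w.1 = [e] ∧ v = u then 1 else 0) =
      if w.1 = [e] then μ u else 0 := by
    by_cases hw : w.1 = [e]
    · simpa [hw] using lexpect_ite_mem μ {u}
    · simpa [hw] using lexpect_const μ 0
  simp only [lexpect_add, lexpect_const, lexpect_ite_mem, hbonus] at hmean
  have hfin : ∑ i ∈ G.nbhd I, μ i ≠ ⊤ := ((pmf_sum_le_one μ _).trans_lt ENNReal.one_lt_top).ne
  refine (ENNReal.add_le_add_iff_right hfin).1 ?_
  calc _ ≤ (w.1.countP (· ∈ I) : ℝ≥0∞) +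
          lexpect (G.transition Φ μ w) (fun y => (y.1.countP (· ∈ G.nbhd I) : ℝ≥0∞)) +
          (if w.1 = [e] then μ u else 0) + ∑ i ∈ I, μ i := by gcongr
    _ ≤ _ := le_of_eq_of_le (by ring) (hmean.trans_eq (by ring))

theorem stab_subset_ncond (hG : G.HasNoBipartiteComponent) (Φ : G.ClassPolicy) :
    G.Stab Φ ⊆ G.Ncond := by
  rintro μ ⟨hμ, hpos⟩
  refine ⟨hμ, fun I hne hI => ?_⟩
  by_contra! hle
  obtain ⟨u, hu_nbhd, hu⟩ := Finset.not_subset.1 (hG I hne hI)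
  obtain ⟨e, he, heu⟩ := mem_nbhd.1 hu_nbhd
  have hsingle : G.IsQueueDetail ([] ++ [e]) := isQueueDetail_nil.append fun ⟨j, hj⟩ =>
    (mem_available.1 hj).2.ne rfl
  have hgrowth (J : Finset V) (w y : G.QueueDetail) (hwy : StepsTo (G.transition Φ μ) w y) :
      (y.1.countP (· ∈ J) : ℝ≥0∞) ≤ w.1.countP (· ∈ J) + 1 := by
    exact_mod_cast countP_le_of_stepsTo hwy (· ∈ J)
  exact not_positiveRecurrent_of_drift (a := ⟨[], isQueueDetail_nil⟩) (z := ⟨[] ++ [e], hsingle⟩)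
    (h := fun w => (w.1.countP (· ∈ I) : ℝ≥0∞)) (l := fun w => (w.1.countP (· ∈ G.nbhd I) : ℝ≥0∞))
    (d := fun w => if w.1 = [e] then μ u else 0) (hgrowth I) (hgrowth (G.nbhd I))
    Nat.cast_zero Nat.cast_zero (lexpect_countP_add_le hI hle he hu heu)
    (fun h => List.cons_ne_nil _ _ (congrArg Subtype.val h)) (stepsTo_append hμ hsingle)
    (by simpa using hμ u) hpos

end Necessity

section Weights

variable [DecidableEq V]

theorem weight_le {β : ℝ} (hβ : 0 ≤ β) (r : Sym2 V → ℝ) (x : V → ℕ) (v j : V) :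
    weight β r x v j ≤ β * (x v + x j) + r s(v, j) := by
  unfold weight
  gcongr
  by_cases hvj : v = j
  · simp [hvj]
  · rw [Finset.sum_pair hvj]

theorem IsQueueDetail.le_weight {w : List V} (hw : G.IsQueueDetail w) {β : ℝ} (hβ : 0 ≤ β)
    (r : Sym2 V → ℝ) {v k : V} (hvk : G.Adj v k) :
    β * (classDetail w v + classDetail w k - 1) + r s(v, k) ≤
      weight β r (classDetail w) v k := by
  unfold weight
  gcongr
  by_cases heq : v = k
  · subst heq
    have hloop : (classDetail w v : ℝ) ≤ 1 := mod_cast hw.2 v hvk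
    rw [Finset.pair_eq_singleton, Finset.sum_singleton]
    linarith
  · rw [Finset.sum_pair heq]
    linarith

end Weights

section Sufficiency

variable [DecidableEq V] [Fintype V] {Φ : G.ClassPolicy} {μ : PMF V} {C : ℕ}

/-- The policy matches an incoming item with a class that has, up to the additive constant `C`, the
longest queue among the classes compatible with the item. -/
def ClassPolicy.MatchesLongestUpTo (Φ : G.ClassPolicy) (C : ℕ) : Prop :=
  ∀ w, G.IsQueueDetail w → ∀ v h, ∀ j ∈ (Φ.choice (classDetail w) v h).support,
    G.maxNeighbor (classDetail w) v ≤ w.count j + C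

theorem exists_maxWeight_matchesLongestUpTo (G : Multigraph V) {β : ℝ} (hβ : 0 < β)
    (r : Sym2 V → ℝ) : ∃ C, (G.maxWeight β r).MatchesLongestUpTo C := by
  obtain ⟨R, hR⟩ := (Set.finite_range fun p : Sym2 V × Sym2 V => (r p.1 - r p.2) / β).bddAbove
  obtain ⟨C, hC⟩ := exists_nat_ge (R + 1)
  refine ⟨C, fun w hw v h j hj => maxNeighbor_le.2 fun k hvk => ?_⟩
  rcases Nat.eq_zero_or_pos (classDetail w k) with hk | hk
  · exact hk.trans_le (Nat.zero_le _)
  have hj_max : j ∈ G.maximizers β r (classDetail w) v :=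
    (PMF.mem_support_uniformOfFinset_iff (G.maximizers_nonempty β r _ v h) j).1 hj
  have hweight : weight β r (classDetail w) v k ≤ weight β r (classDetail w) v j :=
    (Finset.mem_filter.1 hj_max).2 k (mem_available.2 ⟨hvk, hk⟩)
  have hreward : r s(v, j) - r s(v, k) ≤ β * R := by
    rw [mul_comm]
    exact (div_le_iff₀ hβ).1 (hR ⟨(s(v, j), s(v, k)), rfl⟩)
  have hmul : β * (classDetail w k : ℝ) ≤ β * (classDetail w j + (R + 1)) := by
    linarith [hw.le_weight hβ.le r hvk, weight_le hβ.le r (classDetail w) v j]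
  have hle : (classDetail w k : ℝ) ≤ classDetail w j + C :=
    (le_of_mul_le_mul_left hmul hβ).trans (by linarith)
  exact mod_cast hle

/-- The quadratic Lyapunov function `∑ i, x(i)²` of the class detail `x` of a word. -/
def sumSq (w : List V) : ℕ := ∑ i, w.count i ^ 2

theorem sumSq_cons (v : V) (w : List V) : sumSq (v :: w) = sumSq w + 2 * w.count v + 1 := by
  have hterm : ∀ i, (v :: w).count i ^ 2 =
      w.count i ^ 2 + if v = i then 2 * w.count i + 1 else 0 := fun i => by
    rw [List.count_cons]
    split_ifs <;> grind
  simp only [sumSq, hterm, Finset.sum_add_distrib, Finset.sum_ite_eq, Finset.mem_univ, if_true]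
  ring

theorem sumSq_eq_of_perm {w w' : List V} (h : w.Perm w') : sumSq w = sumSq w' := by
  simp only [sumSq, h.count_eq]

theorem sumSq_append_singleton (w : List V) (v : V) :
    sumSq (w ++ [v]) = sumSq w + 2 * w.count v + 1 := by
  rw [sumSq_eq_of_perm (List.perm_append_singleton v w), sumSq_cons]

theorem sumSq_erase_add {w : List V} {j : V} (hj : j ∈ w) :
    sumSq (w.erase j) + 2 * w.count j = sumSq w + 1 := by
  have hperm := List.perm_cons_erase hj
  rw [sumSq_eq_of_perm hperm, hperm.count_eq j, sumSq_cons, List.count_cons_self]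
  ring

theorem ClassPolicy.MatchesLongestUpTo.sumSq_arrival_le (hΦ : Φ.MatchesLongestUpTo C)
    {w y : G.QueueDetail} {v : V} (hy : y ∈ (G.arrival Φ w v).support) :
    sumSq y.1 + 2 * G.maxNeighbor (classDetail w.1) v ≤
      sumSq w.1 + (2 * classDetail w.1 v + (2 * C + 1)) := by
  rcases append_or_erase_of_mem_support_arrival hy with ⟨hnot, hyv⟩ | ⟨h, j, hj, hyj⟩
  · have hzero : G.maxNeighbor (classDetail w.1) v ≤ 0 := maxNeighbor_le.2 fun k hk =>
      Nat.not_lt.1 fun hpos => hnot ⟨k, mem_available.2 ⟨hk, hpos⟩⟩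
    rw [hyv, sumSq_append_singleton]
    simp only [classDetail] at *
    omega
  · have hlongest := hΦ w.1 w.2 v h j hj
    have herase := sumSq_erase_add (adj_and_mem_of_mem_support_choice hj).2
    rw [hyj]
    omega

/- Classes with a self-loop may have one stored item, so the level set `{x > 0}` need not be
independent: the additive constant `2` pays for this level. -/
theorem IsQueueDetail.lexpect_classDetail_add_le {ε : ℝ≥0∞} (hε : ε ≤ 1)
    (hgap : ∀ I : Finset V, I.Nonempty → G.IsIndep (I : Set V) →
      ∑ i ∈ I, μ i + ε ≤ ∑ i ∈ G.nbhd I, μ i) {w : List V} (hw : G.IsQueueDetail w) :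
    lexpect μ (fun v => (classDetail w v : ℝ≥0∞)) + (Finset.univ.sup (classDetail w) : ℕ) * ε ≤
      lexpect μ (fun v => (G.maxNeighbor (classDetail w) v : ℝ≥0∞)) + 2 := by
  set x := classDetail w
  set M := Finset.univ.sup x
  have hx : ∀ v, x v ≤ M := fun v => Finset.le_sup (Finset.mem_univ v)
  have hmax : ∀ v, G.maxNeighbor x v ≤ M := fun v => maxNeighbor_le.2 fun j _ => hx j
  have hlevel : ∀ t ∈ Finset.range M, ∑ v ∈ Finset.univ.filter (fun v => t < x v), μ v + ε ≤
      ∑ v ∈ Finset.univ.filter (fun v => t < G.maxNeighbor x v), μ v +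
        if t = 0 then 2 else 0 := fun t ht => by
    by_cases h0 : t = 0
    · rw [if_pos h0, ← one_add_one_eq_two]
      exact (add_le_add (pmf_sum_le_one μ _) hε).trans le_add_self
    · rw [if_neg h0, add_zero, filter_lt_maxNeighbor]
      obtain ⟨v, _, hv⟩ := Finset.lt_sup_iff.1 (Finset.mem_range.1 ht)
      exact hgap _ ⟨v, by simpa using hv⟩ (hw.isIndep_lt h0)
  have hsum := Finset.sum_le_sum hlevel
  rw [Finset.sum_add_distrib, Finset.sum_add_distrib, Finset.sum_const, Finset.card_range,
    nsmul_eq_mul, Finset.sum_ite_eq', ← lexpect_natCast_eq_sum_range μ hx,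
    ← lexpect_natCast_eq_sum_range μ hmax] at hsum
  refine hsum.trans ?_
  gcongr
  split_ifs <;> simp

theorem ClassPolicy.MatchesLongestUpTo.lexpect_sumSq_add_le (hΦ : Φ.MatchesLongestUpTo C)
    {ε : ℝ≥0∞} (hε : ε ≤ 1) (hgap : ∀ I : Finset V, I.Nonempty → G.IsIndep (I : Set V) →
      ∑ i ∈ I, μ i + ε ≤ ∑ i ∈ G.nbhd I, μ i) (w : G.QueueDetail) :
    lexpect (G.transition Φ μ w) (fun y => (sumSq y.1 : ℝ≥0∞)) +
        2 * ((Finset.univ.sup (classDetail w.1) : ℕ) * ε) ≤ sumSq w.1 + (2 * C + 5) := by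
  have hmean := lexpect_transition_add_le (μ := μ) (Φ := Φ) (w := w)
    (f := fun y => (sumSq y.1 : ℝ≥0∞)) (g := fun _ => (sumSq w.1 : ℝ≥0∞))
    (A := fun v => 2 * (G.maxNeighbor (classDetail w.1) v : ℝ≥0∞))
    (B := fun v => 2 * (classDetail w.1 v : ℝ≥0∞) + (2 * C + 1))
    fun v y hy => by exact_mod_cast hΦ.sumSq_arrival_le hy
  simp only [lexpect_add, lexpect_const, lexpect_const_mul] at hmean
  have hlayer := w.2.lexpect_classDetail_add_le hε hgap
  have hX := lexpect_natCast_ne_top μ (classDetail w.1)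
  have hY := lexpect_natCast_ne_top μ (G.maxNeighbor (classDetail w.1))
  set X := lexpect μ fun v => (classDetail w.1 v : ℝ≥0∞)
  set Y := lexpect μ fun v => (G.maxNeighbor (classDetail w.1) v : ℝ≥0∞)
  have hXY : 2 * X + 2 * Y ≠ ⊤ := by finiteness
  refine (ENNReal.add_le_add_iff_right hXY).1 ?_
  exact le_of_eq_of_le (by ring)
    ((add_le_add hmean (mul_le_mul_right hlayer 2)).trans_eq (by ring))

theorem ClassPolicy.MatchesLongestUpTo.ncond_subset_stab (hΦ : Φ.MatchesLongestUpTo C) :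
    G.Ncond ⊆ G.Stab Φ := by
  intro μ hμ
  obtain ⟨ε, hε_ne, hε_le, hgap⟩ := exists_gap_of_mem_Ncond hμ
  have hD : (2 * C + 5 + 1 : ℝ≥0∞) ≠ ⊤ := by finiteness
  obtain ⟨K, hK⟩ := ENNReal.exists_nat_mul_gt hε_ne hD
  refine ⟨hμ.1, positiveRecurrent_of_drift
    (reflTransGen_stepsTo_transition (exists_adj_of_mem_Ncond hμ) hμ.1)
    (fun w => ENNReal.natCast_ne_top (sumSq w.1))
    (F := (finite_setOf_sup_classDetail_lt G K).toFinset) hD fun w => ?_⟩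
  have hdrift := hΦ.lexpect_sumSq_add_le hε_le hgap w
  by_cases hw : Finset.univ.sup (classDetail w.1) < K
  · rw [Set.indicator_of_mem (by simpa using hw), ← add_assoc]
    gcongr
    exact le_self_add.trans hdrift
  · rw [Set.indicator_of_notMem (by simpa using hw), add_zero]
    have hlarge : (2 * C + 5 + 1 : ℝ≥0∞) ≤
        2 * ((Finset.univ.sup (classDetail w.1) : ℕ) * ε) := calc
      (2 * C + 5 + 1 : ℝ≥0∞) ≤ K * ε := hK.le
      _ ≤ (Finset.univ.sup (classDetail w.1) : ℕ) * ε := by gcongr; exact not_lt.1 hw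
      _ ≤ _ := by rw [two_mul]; exact le_self_add
    refine (ENNReal.add_le_add_iff_right (show (2 * C + 5 : ℝ≥0∞) ≠ ⊤ by finiteness)).1 ?_
    calc _ = _ + (2 * C + 5 + 1 : ℝ≥0∞) := by ring
      _ ≤ _ := by gcongr
      _ ≤ _ := hdrift

end Sufficiency

end Multigraph

theorem mainTheorem2_general {V : Type*} [Fintype V] [DecidableEq V] {G : Multigraph V}
    (hG : G.HasNoBipartiteComponent) {Φ : G.ClassPolicy} {C : ℕ} (hΦ : Φ.MatchesLongestUpTo C) :
    G.Stab Φ = G.Ncond :=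
  (Multigraph.stab_subset_ncond hG Φ).antisymm hΦ.ncond_subset_stab

theorem mainTheorem2 {V : Type*} [Fintype V] [DecidableEq V] (G : Multigraph V)
    (hconn : G.Connected) (hbip : ¬ G.IsBipartiteGraph)
    (β : ℝ) (hβ : 0 < β) (r : Sym2 V → ℝ) :
    G.Stab (G.maxWeight β r) = G.Ncond :=
  have ⟨_, hC⟩ := G.exists_maxWeight_matchesLongestUpTo hβ r
  mainTheorem2_general (Multigraph.hasNoBipartiteComponent_of_connected hconn hbip) hC
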